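/- **The Fibonacci cube algorithm.** Let $G$ be a finite group generated by a finite ordered list $S=(s_1,\dots,s_k)$, and let $a,b,c>0$; put $d=1/a+1/b+1/c$. A random subproduct on $S$ is $s_1^{\varepsilon_1}\cdots s_k^{\varepsilon_k}$ with $\varepsilon_1,\dots,\varepsilon_k$ independent and uniform on $\{0,1\}$. The algorithm builds $G$-valued random variables $\mathcal R_1,\mathcal R_2,\dots$ as follows. $\mathcal R_1$ is the identity. At step $i\ge1$ choose Case 1, 2 or 3 with probability $1/(ad)$, $1/(bd)$, $1/(cd)$ respectively. In Case 1 draw an element $g_i\in G$ from the distribution of $\mathcal R_i$ and set $\mathcal R_{i+1}=\mathcal R_i g_i^{E_i}$; in Case 2 draw $g_i$ from the distribution of $\mathcal R_i$ and set $\mathcal R_{i+1}=g_i^{E_i}\mathcal R_i$; in Case 3 let $g_i$ be a random subproduct on $S$ and set $\mathcal R_{i+1}=\mathcal R_i g_i^{E_i}$. Here the $E_i$ are independent and uniform on $\{0,1\}$, independent of all choices of cases and elements. Once the cases and elements have been chosen they are regarded as fixed, and $\mathcal R_i$ is a random variable through $E_1,\dots,E_{i-1}$ only; thus the distribution of $\mathcal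 R_i$ depends on the random choices made in steps $1,\dots,i-1$. Let $\overline{\mathcal R}_i$ be an independent copy of $\mathcal R_i$ (with the same chosen cases and elements), and let $\|X\|=\bigl(\sum_{g\in G}\Pr(X=g)^2\bigr)^{1/2}$ for a $G$-valued random variable $X$. **Lemma.** For all $a,b,c>0$ there are constants $0<\alpha<1$, $\rho>0$, $0<\beta<1$ and $\iota>0$, depending only on $a,b,c$, such that for every finite group $G$ and every finite list $S$ generating $G$ the following hold. 1. For every integer $i>\iota\log|G|$ and every possible outcome of the choices in steps $1,\dots,i-1$, at least one of the following holds for the resulting $\mathcal R_i$: (i) $\|\mathcal R_{i+1}\|\le\alpha\|\mathcal R_i\|$ with probability at least $\rho$ over the choice of the case and of $g_i$ in step $i$; (ii) $\Pr(\mathcal R_i^{-1}\overline{\mathcal R}_i=g)\ge\frac34(1-\beta)^2/|G|$ for all $g\in G$. 2. For every real $\phi>1$ and every integer $i\ge\iota\log|G|+\frac{\phi}{\rho}\bigl(1+\frac12\log_{1/\alpha}|G|\bigr)$, condition (ii) holds with probability at least $$1-\exp\Bigl(-\tfrac{\phi(1-1/\phi)^2}{4}\,\log_{1/\alpha}|G|\Bigr)$$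 over the choices of cases and elements made in steps $1,\dots,i-1$. -/

import Mathlib

noncomputable section

namespace FibonacciCube

/-- The probability of the event `s` under the discrete law `p`. -/
def prob {Ω : Type*} (p : PMF Ω) (s : Set Ω) : ℝ :=
  (p.toOuterMeasure s).toReal

/-- The uniform law on the exponents `{0, 1}`. -/
def coin : PMF (Fin 2) := PMF.uniformOfFintype (Fin 2)

/-- The law of a random subproduct `g₁ ^ ε₁ * ⋯ * gₖ ^ εₖ` on the list `[g₁, …, gₖ]`, with
independent exponents, each uniform on `{0, 1}`. -/
def randomSubproduct {G : Type*} [Group G] : List G → PMF G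
  | [] => PMF.pure 1
  | g :: S => coin.bind fun e => (randomSubproduct S).map fun r => g ^ (e : ℕ) * r

/-- The law of `R * g ^ E`, where `R` has law `P` and `E` is an independent uniform
`{0, 1}`-random variable. -/
def mulRight {G : Type*} [Group G] (P : PMF G) (g : G) : PMF G :=
  P.bind fun x => coin.map fun e => x * g ^ (e : ℕ)

/-- The law of `g ^ E * R`, where `R` has law `P` and `E` is an independent uniform
`{0, 1}`-random variable. -/
def mulLeft {G : Type*} [Group G] (P : PMF G) (g : G) : PMF G :=
  P.bind fun x => coin.map fun e => g ^ (e : ℕ) * x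

/-- The law of `R⁻¹ * R'`, where `R` and `R'` are independent and both have law `P`. -/
def invMulCopy {G : Type*} [Group G] (P : PMF G) : PMF G :=
  P.bind fun x => P.map fun y => x⁻¹ * y

/-- The `ℓ²` norm of a `G`-valued random variable with law `P`. -/
def l2norm {G : Type*} [Fintype G] (P : PMF G) : ℝ :=
  Real.sqrt (∑ g : G, (P g).toReal ^ 2)

/-- Weights of the three cases: `1/(ad)`, `1/(bd)`, `1/(cd)` with `d = 1/a + 1/b + 1/c`. -/
def caseWeight (a b c : ℝ) : Fin 3 → ℝ :=
  ![1 / (a * (1 / a + 1 / b + 1 / c)), 1 / (b * (1 / a + 1 / b + 1 / c)),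
    1 / (c * (1 / a + 1 / b + 1 / c))]

theorem sum_caseWeight {a b c : ℝ} (ha : 0 < a) (hb : 0 < b) (hc : 0 < c) :
    ∑ j, ENNReal.ofReal (caseWeight a b c j) = 1 := by
  have hd : 0 < 1 / a + 1 / b + 1 / c := by positivity
  have hnn : ∀ j ∈ Finset.univ, 0 ≤ caseWeight a b c j := by
    intro j _
    fin_cases j <;> simp only [caseWeight] <;> simp <;> positivity
  rw [← ENNReal.ofReal_sum_of_nonneg hnn, ← ENNReal.ofReal_one]
  congr 1
  have h : ∀ x : ℝ, 1 / (x * (1 / a + 1 / b + 1 / c)) = (1 / x) / (1 / a + 1 / b + 1 / c) :=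
    fun x => (div_div _ _ _).symm
  simp only [Fin.sum_univ_three, caseWeight, Matrix.cons_val]
  rw [h, h, h, ← add_div, ← add_div, div_self hd.ne']

/-- The law of the case chosen in one step (`0`, `1`, `2` stand for Cases 1, 2, 3). -/
def caseLaw {a b c : ℝ} (ha : 0 < a) (hb : 0 < b) (hc : 0 < c) : PMF (Fin 3) :=
  PMF.ofFintype (fun j => ENNReal.ofReal (caseWeight a b c j)) (sum_caseWeight ha hb hc)

/-- One step of the Fibonacci cube algorithm in the state `P`, the current law of `R i` (given the
group elements chosen so far): the result is the distribution of the next state, over the random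
choice of the case and of the group element `g`. -/
def step {a b c : ℝ} (ha : 0 < a) (hb : 0 < b) (hc : 0 < c)
    {G : Type*} [Group G] (S : List G) (P : PMF G) : PMF (PMF G) :=
  (caseLaw ha hb hc).bind
    ![P.map (mulRight P), P.map (mulLeft P), (randomSubproduct S).map (mulRight P)]

/-- The distribution of the state of the Fibonacci cube algorithm at time `i ≥ 1`, i.e. of the
(random) law of `R i`. The algorithm starts with `R 1 = 1`; time `0` is a dummy index at which
the state is the same. -/
def state {a b c : ℝ} (ha : 0 < a) (hb : 0 < b) (hc : 0 < c)
    {G : Type*} [Group G] (S : List G) : ℕ → PMF (PMF G)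
  | 0 => PMF.pure (PMF.pure 1)
  | 1 => PMF.pure (PMF.pure 1)
  | i + 2 => (state ha hb hc S (i + 1)).bind (step ha hb hc S)

/-- For `R` of law `P` and an independent copy `R'` of it,
`Pr(R⁻¹ * R' = g) ≥ (3/4) (1 - β)² / |G|` for all `g`. -/
def SemiUniform {G : Type*} [Group G] [Fintype G] (β : ℝ) (P : PMF G) : Prop :=
  ∀ g : G, (3 / 4) * (1 - β) ^ 2 / (Fintype.card G : ℝ) ≤ (invMulCopy P g).toReal

end FibonacciCube

end

/-! Let `f` be the autocorrelation of the density of `P`. Right multiplication by a random power of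
`g` turns `‖P‖² = f 1` into `(f 1 + f g) / 2`, so the norm contracts by a fixed factor unless `g` is
an almost period, that is, `f g` is close to `f 1`. Suppose that neither Case 1 nor Case 3 contracts
with conditional probability at least `1/10`. Then `P` is concentrated on almost periods, and a
doubling argument makes these a subgroup `H` (`mul_mem_of_mem_almostPeriods`). A random subproduct
leaves a subgroup not containing `S` with probability at least `1/2`, so `H` is all of `G`; then `f`
is nearly constant and `P` is nearly uniform. This dichotomy holds for every law `P`, and Case 2
matters only in that it does not increase the norm.

For the tail bound, near uniformity persists once reached. Until then the expectation of `‖P‖ ^ s`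
decays geometrically, while `‖P‖² ≥ 1/|G|`. Markov's inequality with a suitable `s` gives the stated
exponent. -/

namespace FibonacciCube

open scoped ENNReal

/-! ### Autocorrelation and almost periods. -/

section Autocorrelation

variable {G : Type*} [Group G] [Fintype G]

/-- The autocorrelation `g ↦ ∑ x, p x * p (x * g)` of a real function on a finite group. -/
def autocorr (p : G → ℝ) (g : G) : ℝ := ∑ x, p x * p (x * g)

theorem autocorr_one (p : G → ℝ) : autocorr p 1 = ∑ x, p x ^ 2 := by
  simp [autocorr, sq]

theorem autocorr_one_nonneg (p : G → ℝ) : 0 ≤ autocorr p 1 := by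
  rw [autocorr_one]
  positivity

theorem autocorr_inv (p : G → ℝ) (g : G) : autocorr p g⁻¹ = autocorr p g := by
  unfold autocorr
  rw [← Equiv.sum_comp (Equiv.mulRight g)]
  simp [mul_comm]

theorem sum_sq_mul_right (p : G → ℝ) (g : G) : ∑ x, p (x * g) ^ 2 = autocorr p 1 := by
  rw [autocorr_one]
  exact Equiv.sum_comp (Equiv.mulRight g) fun x => p x ^ 2

theorem sum_sq_sub_mul_right (p : G → ℝ) (g : G) :
    ∑ x, (p x - p (x * g)) ^ 2 = 2 * (autocorr p 1 - autocorr p g) := by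
  have h : ∀ x, (p x - p (x * g)) ^ 2 = p x ^ 2 + p (x * g) ^ 2 - 2 * (p x * p (x * g)) :=
    fun x => by ring
  simp only [h, Finset.sum_sub_distrib, Finset.sum_add_distrib, ← Finset.mul_sum]
  rw [sum_sq_mul_right, ← autocorr_one]
  unfold autocorr
  ring

theorem autocorr_le (p : G → ℝ) (g : G) : autocorr p g ≤ autocorr p 1 := by
  have h := sum_sq_sub_mul_right p g
  have : 0 ≤ ∑ x, (p x - p (x * g)) ^ 2 := by positivity
  linarith

/-- The defect `f 1 - f g` is half the squared distance from `p` to its translate by `g`. The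
triangle inequality and `(u + v)² ≤ 2u² + 2v²` then give subadditivity up to a factor 2. -/
theorem sub_autocorr_mul_le (p : G → ℝ) (g h : G) :
    autocorr p 1 - autocorr p (g * h) ≤
      2 * (autocorr p 1 - autocorr p g) + 2 * (autocorr p 1 - autocorr p h) := by
  have h1 := sum_sq_sub_mul_right p (g * h)
  have h2 := sum_sq_sub_mul_right p g
  have h3 : ∑ x, (p (x * g) - p (x * g * h)) ^ 2 = 2 * (autocorr p 1 - autocorr p h) := by
    rw [← sum_sq_sub_mul_right p h]
    exact Equiv.sum_comp (Equiv.mulRight g) fun x => (p x - p (x * h)) ^ 2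
  have h4 : ∑ x, (p x - p (x * (g * h))) ^ 2 ≤
      ∑ x, (2 * (p x - p (x * g)) ^ 2 + 2 * (p (x * g) - p (x * g * h)) ^ 2) := by
    refine Finset.sum_le_sum fun x _ => ?_
    rw [← mul_assoc]
    nlinarith [sq_nonneg ((p x - p (x * g)) - (p (x * g) - p (x * g * h)))]
  rw [Finset.sum_add_distrib, ← Finset.mul_sum, ← Finset.mul_sum] at h4
  linarith

theorem sum_autocorr (p : G → ℝ) : ∑ g, autocorr p g = (∑ x, p x) ^ 2 := by
  unfold autocorr
  rw [Finset.sum_comm, sq, Finset.sum_mul]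
  refine Finset.sum_congr rfl fun x _ => ?_
  rw [← Finset.mul_sum]
  congr 1
  exact Equiv.sum_comp (Equiv.mulLeft x) p

theorem one_le_card_mul_autocorr_one {p : G → ℝ} (hp : ∑ x, p x = 1) :
    1 ≤ (Fintype.card G : ℝ) * autocorr p 1 := by
  have h := sq_sum_le_card_mul_sum_sq (s := (Finset.univ : Finset G)) (f := p)
  rwa [hp, one_pow, ← autocorr_one, Finset.card_univ] at h

/-- Expand the squared distance from `p` plus its translate to the constant `2 / |G|`. A small norm
thus bounds every autocorrelation from below. -/
theorem autocorr_ge {p : G → ℝ} (hp : ∑ x, p x = 1) (g : G) :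
    2 / (Fintype.card G : ℝ) - autocorr p 1 ≤ autocorr p g := by
  set u : ℝ := 1 / (Fintype.card G : ℝ) with hu
  have hc : (0 : ℝ) < Fintype.card G := by exact_mod_cast Fintype.card_pos
  have hcu : (Fintype.card G : ℝ) * u = 1 := by rw [hu]; field_simp
  have h0 : 0 ≤ ∑ x, (p x + p (x * g) - 2 * u) ^ 2 := by positivity
  have h1 : ∀ x, (p x + p (x * g) - 2 * u) ^ 2 = p x ^ 2 + p (x * g) ^ 2 +
      2 * (p x * p (x * g)) + 4 * u ^ 2 - 4 * u * p x - 4 * u * p (x * g) := fun x => by ring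
  have h2 : ∑ x, p (x * g) = 1 := by
    rw [← hp]
    exact Equiv.sum_comp (Equiv.mulRight g) p
  simp only [h1, Finset.sum_sub_distrib, Finset.sum_add_distrib, ← Finset.mul_sum] at h0
  rw [sum_sq_mul_right, ← autocorr_one, hp, h2, Finset.sum_const, Finset.card_univ,
    nsmul_eq_mul] at h0
  have h3 : 2 / (Fintype.card G : ℝ) = 2 * u := by rw [hu]; ring
  rw [h3]
  change 0 ≤ _ + 2 * autocorr p g + _ - _ - _ at h0
  have h4 : (Fintype.card G : ℝ) * (4 * u ^ 2) = 4 * u := by linear_combination 4 * u * hcu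
  linarith

open Classical in
/-- The elements at which the autocorrelation is at least `1 - t` times its maximum. -/
noncomputable def almostPeriods (p : G → ℝ) (t : ℝ) : Finset G :=
  {g | (1 - t) * autocorr p 1 ≤ autocorr p g}

theorem mem_almostPeriods {p : G → ℝ} {t : ℝ} {g : G} :
    g ∈ almostPeriods p t ↔ (1 - t) * autocorr p 1 ≤ autocorr p g := by
  simp [almostPeriods]

theorem almostPeriods_mono (p : G → ℝ) {s t : ℝ} (h : s ≤ t) :
    almostPeriods p s ⊆ almostPeriods p t := by
  intro g hg
  rw [mem_almostPeriods] at *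
  nlinarith [autocorr_one_nonneg p]

theorem inv_mem_almostPeriods {p : G → ℝ} {t : ℝ} {g : G} (hg : g ∈ almostPeriods p t) :
    g⁻¹ ∈ almostPeriods p t := by
  rw [mem_almostPeriods] at *
  rwa [autocorr_inv]

theorem mul_mem_almostPeriods {p : G → ℝ} {s t : ℝ} {g h : G} (hg : g ∈ almostPeriods p s)
    (hh : h ∈ almostPeriods p t) : g * h ∈ almostPeriods p (2 * s + 2 * t) := by
  rw [mem_almostPeriods] at *
  linarith [sub_autocorr_mul_le p g h]

theorem card_almostPeriods_mul_le {p : G → ℝ} (h0 : ∀ x, 0 ≤ p x) (hp : ∑ x, p x = 1) (t : ℝ) :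
    (almostPeriods p t).card * ((1 - t) * autocorr p 1) ≤ 1 := by
  calc (almostPeriods p t).card * ((1 - t) * autocorr p 1)
      = ∑ _g ∈ almostPeriods p t, (1 - t) * autocorr p 1 := by
        rw [Finset.sum_const, nsmul_eq_mul]
    _ ≤ ∑ g ∈ almostPeriods p t, autocorr p g :=
        Finset.sum_le_sum fun g hg => mem_almostPeriods.1 hg
    _ ≤ ∑ g, autocorr p g :=
        Finset.sum_le_sum_of_subset_of_nonneg (Finset.subset_univ _) fun g _ _ =>
          Finset.sum_nonneg fun x _ => mul_nonneg (h0 _) (h0 _)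
    _ = 1 := by rw [sum_autocorr, hp, one_pow]

theorem sq_sum_le_card_mul_autocorr_one (p : G → ℝ) (s : Finset G) :
    (∑ x ∈ s, p x) ^ 2 ≤ s.card * autocorr p 1 := by
  refine sq_sum_le_card_mul_sum_sq.trans ?_
  rw [autocorr_one]
  gcongr
  exact Finset.subset_univ s

/-- A priori `x = g * h` has defect `2(1/25 + 1/25) = 16/100`, so `x * A` and `A` both lie in `B`,
as `2(16/100 + 1/100) = 34/100`. Since `B` is too small to hold them disjointly, `x` is a quotient
of two elements of `A`, and its defect falls back to `2(1/100 + 1/100) = 1/25`. -/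
theorem mul_mem_of_mem_almostPeriods {p : G → ℝ} (h0 : ∀ x, 0 ≤ p x) (hp : ∑ x, p x = 1)
    (hK : 9 / 10 ≤ ∑ x ∈ almostPeriods p (1 / 100), p x) {g h : G}
    (hg : g ∈ almostPeriods p (1 / 25)) (hh : h ∈ almostPeriods p (1 / 25)) :
    g * h ∈ almostPeriods p (1 / 25) := by
  classical
  set A := almostPeriods p (1 / 100) with hA
  set B := almostPeriods p (34 / 100) with hB
  have hx : g * h ∈ almostPeriods p (16 / 100) := by
    have := mul_mem_almostPeriods hg hh
    norm_num at this ⊢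
    exact this
  set x := g * h
  -- Cauchy–Schwarz gives `|A| f 1 ≥ 0.81`, whereas `f` having total mass 1 gives `|B| f 1 ≤ 1 /
  -- 0.66 < 1.62`.
  have hcard : B.card < A.card + A.card := by
    have h1 := card_almostPeriods_mul_le h0 hp (34 / 100)
    have h2 := sq_sum_le_card_mul_autocorr_one p A
    rw [← hB] at h1
    have h3 : (9 / 10 : ℝ) ^ 2 ≤ A.card * autocorr p 1 :=
      (pow_le_pow_left₀ (by norm_num) hK 2).trans h2
    have h4 : 0 ≤ autocorr p 1 := autocorr_one_nonneg p
    have : (B.card : ℝ) < A.card + A.card := by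
      by_contra! hcon
      nlinarith [mul_le_mul_of_nonneg_right hcon h4]
    exact_mod_cast this
  have hAB : A ⊆ B := almostPeriods_mono p (by norm_num)
  have hxA : A.image (x * ·) ⊆ B := by
    intro y hy
    obtain ⟨z, hz, rfl⟩ := Finset.mem_image.1 hy
    have := mul_mem_almostPeriods hx hz
    rw [hB]
    norm_num at this ⊢
    exact this
  have hne : ¬ Disjoint (A.image (x * ·)) A := by
    intro hd
    have h1 := Finset.card_le_card (Finset.union_subset hxA hAB)
    rw [Finset.card_union_of_disjoint hd,
      Finset.card_image_of_injective _ (mul_right_injective x)] at h1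
    omega
  obtain ⟨y, hy, hyA⟩ := Finset.not_disjoint_iff.1 hne
  obtain ⟨z, hz, rfl⟩ := Finset.mem_image.1 hy
  have := mul_mem_almostPeriods hyA (inv_mem_almostPeriods hz)
  norm_num at this ⊢
  exact this

/-- The subgroup of almost periods of a probability density that is mostly supported on its own
almost periods. -/
noncomputable def almostPeriodSubgroup {p : G → ℝ} (h0 : ∀ x, 0 ≤ p x) (hp : ∑ x, p x = 1)
    (hK : 9 / 10 ≤ ∑ x ∈ almostPeriods p (1 / 100), p x) : Subgroup G where
  carrier := {g | g ∈ almostPeriods p (1 / 25)}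
  mul_mem' := mul_mem_of_mem_almostPeriods h0 hp hK
  one_mem' := mem_almostPeriods.2 (by linarith [autocorr_one_nonneg p])
  inv_mem' := inv_mem_almostPeriods

end Autocorrelation

/-! ### Laws, norms, and the dichotomy between contraction and near uniformity. -/

section Laws

theorem coin_apply (e : Fin 2) : coin e = 2⁻¹ := by
  simp [coin]

theorem coin_bind_apply {A : Type*} (f : Fin 2 → PMF A) (y : A) :
    (coin.bind f) y = 2⁻¹ * f 0 y + 2⁻¹ * f 1 y := by
  rw [PMF.bind_apply, tsum_fintype, Fin.sum_univ_two, coin_apply, coin_apply]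

theorem map_equiv_apply {A B : Type*} (p : PMF A) (e : A ≃ B) (y : B) :
    (p.map e) y = p (e.symm y) := by
  classical
  rw [PMF.map_apply, tsum_eq_single (e.symm y)]
  · simp
  · intro x hx
    rw [if_neg]
    rintro rfl
    simp at hx

theorem prob_nonneg {A : Type*} (p : PMF A) (s : Set A) : 0 ≤ prob p s := ENNReal.toReal_nonneg

theorem toOuterMeasure_le_one {A : Type*} (p : PMF A) (s : Set A) : p.toOuterMeasure s ≤ 1 := by
  rw [PMF.toOuterMeasure_apply]
  exact (ENNReal.tsum_le_tsum fun x => Set.indicator_le_self s p x).trans p.tsum_coe.le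

theorem toOuterMeasure_ne_top {A : Type*} (p : PMF A) (s : Set A) : p.toOuterMeasure s ≠ ∞ :=
  ne_top_of_le_ne_top ENNReal.one_ne_top (toOuterMeasure_le_one p s)

theorem prob_mono {A : Type*} (p : PMF A) {s t : Set A} (h : s ⊆ t) : prob p s ≤ prob p t :=
  ENNReal.toReal_mono (toOuterMeasure_ne_top p t) (p.toOuterMeasure.mono h)

theorem prob_add_prob_compl {A : Type*} (p : PMF A) (s : Set A) : prob p s + prob p sᶜ = 1 := by
  unfold prob
  rw [← ENNReal.toReal_add (toOuterMeasure_ne_top p s) (toOuterMeasure_ne_top p sᶜ),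
    PMF.toOuterMeasure_apply, PMF.toOuterMeasure_apply, ← ENNReal.tsum_add]
  have h : ∀ x, s.indicator p x + sᶜ.indicator p x = p x :=
    fun x => Set.indicator_self_add_compl_apply s p x
  simp only [h, p.tsum_coe, ENNReal.toReal_one]

theorem prob_map {A B : Type*} (p : PMF A) (f : A → B) (s : Set B) :
    prob (p.map f) s = prob p (f ⁻¹' s) := by
  unfold prob
  rw [PMF.toOuterMeasure_map_apply]

theorem mul_prob_le_prob_bind {A B : Type*} (p : PMF A) (f : A → PMF B) (s : Set B) (a : A) :
    (p a).toReal * prob (f a) s ≤ prob (p.bind f) s := by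
  unfold prob
  rw [← ENNReal.toReal_mul]
  refine ENNReal.toReal_mono (toOuterMeasure_ne_top _ _) ?_
  rw [PMF.toOuterMeasure_bind_apply]
  exact ENNReal.le_tsum (f := fun a => p a * (f a).toOuterMeasure s) a

theorem prob_coin_bind {A : Type*} (f : Fin 2 → PMF A) (s : Set A) :
    prob (coin.bind f) s = (prob (f 0) s + prob (f 1) s) / 2 := by
  unfold prob
  rw [PMF.toOuterMeasure_bind_apply, tsum_fintype, Fin.sum_univ_two, coin_apply, coin_apply,
    ENNReal.toReal_add, ENNReal.toReal_mul, ENNReal.toReal_mul]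
  · simp
    ring
  all_goals exact ENNReal.mul_ne_top (by simp) (toOuterMeasure_ne_top _ _)

theorem prob_eq_sum {A : Type*} [Fintype A] (p : PMF A) (s : Finset A) :
    prob p (s : Set A) = ∑ x ∈ s, (p x).toReal := by
  unfold prob
  rw [PMF.toOuterMeasure_apply_finset, ENNReal.toReal_sum fun x _ => p.apply_ne_top x]

theorem sum_toReal {A : Type*} [Fintype A] (p : PMF A) : ∑ x, (p x).toReal = 1 := by
  rw [← ENNReal.toReal_sum fun x _ => p.apply_ne_top x, ← tsum_fintype (L := .unconditional _),
    p.tsum_coe, ENNReal.toReal_one]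

/-- The real-valued density of a law on a set. -/
noncomputable def density {A : Type*} (P : PMF A) (g : A) : ℝ := (P g).toReal

theorem density_nonneg {A : Type*} (P : PMF A) (g : A) : 0 ≤ density P g := ENNReal.toReal_nonneg

theorem sum_density {A : Type*} [Fintype A] (P : PMF A) : ∑ g, density P g = 1 := sum_toReal P

theorem l2norm_nonneg {A : Type*} [Fintype A] (P : PMF A) : 0 ≤ l2norm P := Real.sqrt_nonneg _

theorem tsum_bind_mul {A B : Type*} (p : PMF A) (q : A → PMF B) (F : B → ℝ≥0∞) :
    ∑' y, (p.bind q) y * F y = ∑' x, p x * ∑' y, q x y * F y := by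
  simp only [PMF.bind_apply, ← ENNReal.tsum_mul_right, ← ENNReal.tsum_mul_left]
  rw [ENNReal.tsum_comm]
  simp only [mul_assoc]

variable {G : Type*} [Group G]

theorem mulRight_toReal (P : PMF G) (g y : G) :
    (mulRight P g y).toReal = ((P y).toReal + (P (y * g⁻¹)).toReal) / 2 := by
  have h : mulRight P g = coin.bind fun e => P.map (Equiv.mulRight (g ^ (e : ℕ))) := by
    unfold mulRight
    simp only [← PMF.bind_pure_comp]
    rw [PMF.bind_comm]
    -- In `mulRight` the exponent is drawn from the image of `coin` in `ℕ`.
    change (coin.bind fun e => PMF.pure (e : ℕ)).bind _ = _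
    rw [PMF.bind_bind]
    congr 1
    funext e
    rw [PMF.pure_bind]
    rfl
  rw [h, coin_bind_apply, map_equiv_apply, map_equiv_apply, ENNReal.toReal_add,
    ENNReal.toReal_mul, ENNReal.toReal_mul]
  · simp only [Equiv.mulRight_symm, Equiv.coe_mulRight, ENNReal.toReal_inv, ENNReal.toReal_ofNat,
      Fin.val_zero, Fin.val_one, pow_zero, pow_one, inv_one, mul_one]
    ring
  all_goals exact ENNReal.mul_ne_top (by simp) (P.apply_ne_top _)

theorem mulLeft_toReal (P : PMF G) (g y : G) :
    (mulLeft P g y).toReal = ((P y).toReal + (P (g⁻¹ * y)).toReal) / 2 := by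
  have h : mulLeft P g = coin.bind fun e => P.map (Equiv.mulLeft (g ^ (e : ℕ))) := by
    unfold mulLeft
    simp only [← PMF.bind_pure_comp]
    rw [PMF.bind_comm]
    change (coin.bind fun e => PMF.pure (e : ℕ)).bind _ = _
    rw [PMF.bind_bind]
    congr 1
    funext e
    rw [PMF.pure_bind]
    rfl
  rw [h, coin_bind_apply, map_equiv_apply, map_equiv_apply, ENNReal.toReal_add,
    ENNReal.toReal_mul, ENNReal.toReal_mul]
  · simp only [Equiv.mulLeft_symm, Equiv.coe_mulLeft, ENNReal.toReal_inv, ENNReal.toReal_ofNat,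
      Fin.val_zero, Fin.val_one, pow_zero, pow_one, inv_one, one_mul]
    ring
  all_goals exact ENNReal.mul_ne_top (by simp) (P.apply_ne_top _)

/-- A leading factor in `H` does not affect membership. If the leading `g` is outside `H`, then `r`
and `g * r` are never both in `H`, so its coin alone gives the bound. -/
theorem half_le_prob_randomSubproduct (H : Subgroup G) (S : List G) (hS : ∃ g ∈ S, g ∉ H) :
    1 / 2 ≤ prob (randomSubproduct S) {g | g ∉ H} := by
  induction S with
  | nil => simp at hS
  | cons g S ih =>
    rw [randomSubproduct, prob_coin_bind, prob_map, prob_map]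
    simp only [Fin.val_zero, pow_zero, one_mul, Fin.val_one, pow_one, Set.preimage_ofPred_eq]
    by_cases hg : g ∈ H
    · have hS' : ∃ g ∈ S, g ∉ H := by
        obtain ⟨x, hx, hxH⟩ := hS
        rcases List.mem_cons.1 hx with rfl | hx
        · exact absurd hg hxH
        · exact ⟨x, hx, hxH⟩
      simp only [H.mul_mem_cancel_left hg]
      linarith [ih hS']
    · have h1 : ({r | r ∉ H}ᶜ : Set G) ⊆ {r | g * r ∉ H} := by
        intro r hr
        simp only [Set.mem_compl_iff, Set.mem_ofPred_eq, not_not] at hr ⊢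
        rwa [H.mul_mem_cancel_right hr]
      have h2 := prob_mono (randomSubproduct S) h1
      have h3 := prob_add_prob_compl (randomSubproduct S) {r | r ∉ H}
      linarith

variable [Fintype G]

theorem invMulCopy_toReal (P : PMF G) (g : G) :
    (invMulCopy P g).toReal = autocorr (density P) g := by
  unfold invMulCopy autocorr density
  rw [PMF.bind_apply, tsum_fintype,
    ENNReal.toReal_sum fun x _ => ENNReal.mul_ne_top (P.apply_ne_top _) (PMF.apply_ne_top _ _)]
  refine Finset.sum_congr rfl fun x _ => ?_
  rw [ENNReal.toReal_mul]
  have h := map_equiv_apply P (Equiv.mulLeft x⁻¹) g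
  simp only [Equiv.mulLeft_symm, inv_inv, Equiv.coe_mulLeft] at h
  rw [h]

theorem l2norm_sq (P : PMF G) : l2norm P ^ 2 = autocorr (density P) 1 := by
  rw [autocorr_one]
  exact Real.sq_sqrt (by positivity)

theorem l2norm_mulRight_sq (P : PMF G) (g : G) :
    l2norm (mulRight P g) ^ 2 = (autocorr (density P) 1 + autocorr (density P) g) / 2 := by
  rw [l2norm_sq, autocorr_one]
  have h : ∀ y, density (mulRight P g) y ^ 2 = density P y ^ 2 / 4 + density P (y * g⁻¹) ^ 2 / 4 +
      density P y * density P (y * g⁻¹) / 2 := by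
    intro y
    have := mulRight_toReal P g y
    change density _ _ = (density _ _ + density _ _) / 2 at this
    rw [this]
    ring
  simp only [h, Finset.sum_add_distrib, ← Finset.sum_div]
  rw [sum_sq_mul_right, ← autocorr_one, ← autocorr_inv _ g]
  change _ + _ + autocorr (density P) g⁻¹ / 2 = _
  ring

theorem l2norm_mulRight_le (P : PMF G) (g : G) : l2norm (mulRight P g) ≤ l2norm P := by
  refine (sq_le_sq₀ (l2norm_nonneg _) (l2norm_nonneg P)).1 ?_
  rw [l2norm_mulRight_sq, l2norm_sq]
  linarith [autocorr_le (density P) g]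

theorem l2norm_mulLeft_le (P : PMF G) (g : G) : l2norm (mulLeft P g) ≤ l2norm P := by
  refine (sq_le_sq₀ (l2norm_nonneg _) (l2norm_nonneg P)).1 ?_
  rw [l2norm_sq, l2norm_sq, autocorr_one]
  have h : ∀ y, density (mulLeft P g) y ^ 2 ≤
      density P y ^ 2 / 2 + density P (g⁻¹ * y) ^ 2 / 2 := by
    intro y
    have := mulLeft_toReal P g y
    change density _ _ = (density _ _ + density _ _) / 2 at this
    rw [this]
    nlinarith [sq_nonneg (density P y - density P (g⁻¹ * y))]
  refine (Finset.sum_le_sum fun y _ => h y).trans ?_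
  have h2 : ∑ y, density P (g⁻¹ * y) ^ 2 = ∑ y, density P y ^ 2 :=
    Equiv.sum_comp (Equiv.mulLeft g⁻¹) fun y => density P y ^ 2
  rw [Finset.sum_add_distrib, ← Finset.sum_div, ← Finset.sum_div, h2, autocorr_one]
  linarith

theorem one_le_card_mul_l2norm_sq (P : PMF G) : 1 ≤ (Fintype.card G : ℝ) * l2norm P ^ 2 := by
  rw [l2norm_sq]
  exact one_le_card_mul_autocorr_one (sum_density P)

theorem l2norm_pure_one : l2norm (PMF.pure (1 : G)) = 1 := by
  classical
  unfold l2norm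
  have h : ∀ g : G, ((PMF.pure (1 : G)) g).toReal ^ 2 = if g = 1 then (1 : ℝ) else 0 := by
    intro g
    rw [PMF.pure_apply]
    split_ifs <;> simp
  simp only [h]
  simp

/-- The law `P` is close to uniform in the `ℓ²` sense. -/
def NearUniform (P : PMF G) : Prop :=
  Fintype.card G * l2norm P ^ 2 ≤ 25 / 24

theorem NearUniform.semiUniform {P : PMF G} (h : NearUniform P) : SemiUniform (1 / 2) P := by
  intro g
  have hc : (0 : ℝ) < Fintype.card G := by exact_mod_cast Fintype.card_pos
  rw [invMulCopy_toReal]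
  refine le_trans ?_ (autocorr_ge (sum_density P) g)
  rw [← l2norm_sq, div_le_iff₀ hc, sub_mul, div_mul_cancel₀ _ hc.ne']
  unfold NearUniform at h
  -- The available bound is `2 - 25/24 = 23/24`, well above the required `3/16`.
  linarith

theorem NearUniform.of_l2norm_le {P Q : PMF G} (h : NearUniform P) (hle : l2norm Q ≤ l2norm P) :
    NearUniform Q := by
  unfold NearUniform at *
  refine le_trans ?_ h
  have := l2norm_nonneg Q
  gcongr

/-- The squared norm drops by the factor `1 - 1/200`, which is below `(399/400)²`. -/
theorem l2norm_mulRight_le_of_notMem {P : PMF G} {g : G}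
    (hg : g ∉ almostPeriods (density P) (1 / 100)) :
    l2norm (mulRight P g) ≤ 399 / 400 * l2norm P := by
  refine (sq_le_sq₀ (l2norm_nonneg _) (by linarith [l2norm_nonneg P])).1 ?_
  rw [mem_almostPeriods, not_le] at hg
  rw [l2norm_mulRight_sq, mul_pow, l2norm_sq]
  linarith [autocorr_one_nonneg (density P)]

theorem nearUniform_of_prob_lt {P : PMF G} {S : List G} (hS : Subgroup.closure {g | g ∈ S} = ⊤)
    (h1 : prob P {g | l2norm (mulRight P g) ≤ 399 / 400 * l2norm P} < 1 / 10)
    (h2 : prob (randomSubproduct S) {g | l2norm (mulRight P g) ≤ 399 / 400 * l2norm P} < 1 / 10) :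
    NearUniform P := by
  have hK : 9 / 10 ≤ ∑ x ∈ almostPeriods (density P) (1 / 100), density P x := by
    have h3 := prob_eq_sum P (almostPeriods (density P) (1 / 100))
    change _ = ∑ x ∈ _, density P x at h3
    rw [← h3]
    have h4 := prob_add_prob_compl P (almostPeriods (density P) (1 / 100) : Set G)
    have h5 : prob P (almostPeriods (density P) (1 / 100) : Set G)ᶜ ≤
        prob P {g | l2norm (mulRight P g) ≤ 399 / 400 * l2norm P} :=
      prob_mono P fun g hg => l2norm_mulRight_le_of_notMem (by simpa using hg)
    linarith
  set H := almostPeriodSubgroup (density_nonneg P) (sum_density P) hK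
  have hHmem : ∀ g, g ∈ H ↔ g ∈ almostPeriods (density P) (1 / 25) := fun g => Iff.rfl
  have hSH : ∀ g ∈ S, g ∈ H := by
    by_contra! hcon
    have h3 := half_le_prob_randomSubproduct H S hcon
    have h4 : prob (randomSubproduct S) {g | g ∉ H} ≤
        prob (randomSubproduct S) {g | l2norm (mulRight P g) ≤ 399 / 400 * l2norm P} := by
      refine prob_mono _ fun g hg => l2norm_mulRight_le_of_notMem fun hg' => hg ?_
      exact (hHmem g).2 (almostPeriods_mono _ (by norm_num) hg')
    linarith
  have htop : ∀ g, g ∈ H := by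
    intro g
    have h3 : Subgroup.closure {g | g ∈ S} ≤ H := (Subgroup.closure_le H).2 hSH
    exact h3 (hS ▸ Subgroup.mem_top g)
  have h3 : almostPeriods (density P) (1 / 25) = Finset.univ :=
    Finset.eq_univ_of_forall fun g => (hHmem g).1 (htop g)
  have h4 := card_almostPeriods_mul_le (density_nonneg P) (sum_density P) (1 / 25)
  rw [h3, Finset.card_univ, ← l2norm_sq] at h4
  unfold NearUniform
  linarith

end Laws

/-! ### One step of the algorithm and the decay of a potential. -/

section Algorithm

variable {a b c : ℝ} (ha : 0 < a) (hb : 0 < b) (hc : 0 < c) {G : Type*} [Group G]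

theorem caseWeight_pos {a b c : ℝ} (ha : 0 < a) (hb : 0 < b) (hc : 0 < c) (j : Fin 3) : 0 < caseWeight a b c j := by
  fin_cases j <;> simp only [caseWeight] <;> simp <;> positivity

theorem caseLaw_toReal (j : Fin 3) : (caseLaw ha hb hc j).toReal = caseWeight a b c j := by
  rw [caseLaw, PMF.ofFintype_apply, ENNReal.toReal_ofReal (caseWeight_pos ha hb hc j).le]

theorem mem_support_step {S : List G} {P Q : PMF G} (hQ : Q ∈ (step ha hb hc S P).support) :
    ∃ g, Q = mulRight P g ∨ Q = mulLeft P g := by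
  rw [step, PMF.mem_support_bind_iff] at hQ
  obtain ⟨j, -, hj⟩ := hQ
  fin_cases j
  all_goals
    simp only [Fin.zero_eta, Fin.mk_one, Fin.reduceFinMk, Matrix.cons_val, PMF.mem_support_map_iff]
      at hj
    obtain ⟨g, -, rfl⟩ := hj
    exact ⟨g, by simp⟩

theorem tsum_state_mul_le {S : List G} {F : PMF G → ℝ≥0∞} {r : ℝ≥0∞}
    (hF : ∀ P, ∑' Q, step ha hb hc S P Q * F Q ≤ r * F P) (n : ℕ) :
    ∑' Q, state ha hb hc S (n + 1) Q * F Q ≤ r ^ n * F (PMF.pure 1) := by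
  induction n with
  | zero =>
    rw [zero_add, state, pow_zero, one_mul, tsum_eq_single (PMF.pure 1)]
    · simp
    · intro Q hQ
      rw [PMF.pure_apply_of_ne _ _ hQ, zero_mul]
  | succ n ih =>
    rw [state, tsum_bind_mul]
    calc ∑' P, state ha hb hc S (n + 1) P * ∑' Q, step ha hb hc S P Q * F Q
        ≤ ∑' P, r * (state ha hb hc S (n + 1) P * F P) := by
          refine ENNReal.tsum_le_tsum fun P => ?_
          rw [mul_left_comm]
          gcongr
          exact hF P
      _ = r * ∑' P, state ha hb hc S (n + 1) P * F P := ENNReal.tsum_mul_left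
      _ ≤ r * (r ^ n * F (PMF.pure 1)) := by gcongr
      _ = r ^ (n + 1) * F (PMF.pure 1) := by rw [pow_succ', mul_assoc]

variable [Fintype G]

theorem l2norm_le_of_mem_support_step {S : List G} {P Q : PMF G}
    (hQ : Q ∈ (step ha hb hc S P).support) : l2norm Q ≤ l2norm P := by
  obtain ⟨g, rfl | rfl⟩ := mem_support_step ha hb hc hQ
  · exact l2norm_mulRight_le P g
  · exact l2norm_mulLeft_le P g

theorem le_prob_step_or_nearUniform {S : List G} (hS : Subgroup.closure {g | g ∈ S} = ⊤)
    (P : PMF G) :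
    min (caseWeight a b c 0) (caseWeight a b c 2) / 10 ≤
        prob (step ha hb hc S P) {Q | l2norm Q ≤ 399 / 400 * l2norm P} ∨ NearUniform P := by
  rw [or_iff_not_imp_left, not_le]
  intro h
  have h0 := mul_prob_le_prob_bind (caseLaw ha hb hc)
    ![P.map (mulRight P), P.map (mulLeft P), (randomSubproduct S).map (mulRight P)]
    {Q | l2norm Q ≤ 399 / 400 * l2norm P}
  have h1 := (h0 0).trans_lt h
  have h2 := (h0 2).trans_lt h
  simp only [Matrix.cons_val, caseLaw_toReal, prob_map, Set.preimage_ofPred_eq] at h1 h2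
  refine nearUniform_of_prob_lt hS ?_ ?_
  · refine lt_of_mul_lt_mul_left ?_ (caseWeight_pos ha hb hc 0).le
    linarith [min_le_left (caseWeight a b c 0) (caseWeight a b c 2)]
  · refine lt_of_mul_lt_mul_left ?_ (caseWeight_pos ha hb hc 2).le
    linarith [min_le_right (caseWeight a b c 0) (caseWeight a b c 2)]

open Classical in
/-- A power of the `ℓ²` norm, cut off to zero at the nearly uniform laws. -/
noncomputable def potential (s : ℝ) (P : PMF G) : ℝ≥0∞ :=
  if NearUniform P then 0 else ENNReal.ofReal (l2norm P ^ s)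

/-- Near uniformity is absorbing, so a potential of zero stays zero. Otherwise the norm never grows,
and with probability at least `ρ` its power `s` gains the factor `(399/400) ^ s`. -/
theorem tsum_step_mul_potential_le {S : List G} {s ρ : ℝ} (hs : 0 ≤ s)
    (P : PMF G) (h : ρ ≤ prob (step ha hb hc S P) {Q | l2norm Q ≤ 399 / 400 * l2norm P} ∨
      NearUniform P) (hρ : 0 ≤ ρ) :
    ∑' Q, step ha hb hc S P Q * potential s Q ≤
      ENNReal.ofReal (1 - ρ * (1 - (399 / 400) ^ s)) * potential s P := by
  classical
  by_cases hP : NearUniform P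
  · rw [potential, if_pos hP, mul_zero]
    refine le_of_eq (ENNReal.tsum_eq_zero.2 fun Q => ?_)
    by_cases hQ : Q ∈ (step ha hb hc S P).support
    · rw [potential, if_pos (hP.of_l2norm_le (l2norm_le_of_mem_support_step ha hb hc hQ)),
        mul_zero]
    · rw [(PMF.apply_eq_zero_iff _ _).2 hQ, zero_mul]
  · replace h := h.resolve_right hP
    set q := step ha hb hc S P
    set D : Set (PMF G) := {Q | l2norm Q ≤ 399 / 400 * l2norm P} with hD
    set V := l2norm P ^ s with hV
    set θ : ℝ := (399 / 400) ^ s with hθ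
    have hV0 : 0 ≤ V := Real.rpow_nonneg (l2norm_nonneg P) s
    have hθ0 : 0 ≤ θ := by positivity
    have hθ1 : θ ≤ 1 := Real.rpow_le_one (by norm_num) (by norm_num) hs
    have hρ1 : ρ ≤ 1 := by
      have := prob_add_prob_compl q D
      linarith [prob_nonneg q Dᶜ]
    -- The drop is written additively because subtraction in `ℝ≥0∞` truncates.
    have hpt : ∀ Q, q Q * potential s Q + D.indicator q Q * ENNReal.ofReal ((1 - θ) * V) ≤
        q Q * ENNReal.ofReal V := by
      intro Q
      by_cases hQ : Q ∈ q.support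
      · have hle : l2norm Q ^ s ≤ V := Real.rpow_le_rpow (l2norm_nonneg Q)
          (l2norm_le_of_mem_support_step ha hb hc hQ) hs
        have hpot : potential s Q ≤ ENNReal.ofReal (l2norm Q ^ s) := by
          unfold potential
          split_ifs
          · exact zero_le
          · exact le_rfl
        by_cases hQD : Q ∈ D
        · rw [Set.indicator_of_mem hQD, ← mul_add]
          gcongr
          have hle' : l2norm Q ^ s ≤ θ * V := by
            rw [hθ, hV, ← Real.mul_rpow (by norm_num) (l2norm_nonneg P)]
            exact Real.rpow_le_rpow (l2norm_nonneg Q) hQD hs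
          refine (add_le_add_left hpot _).trans ?_
          rw [← ENNReal.ofReal_add (Real.rpow_nonneg (l2norm_nonneg Q) s)
            (mul_nonneg (by linarith) hV0)]
          exact ENNReal.ofReal_le_ofReal (by linarith)
        · rw [Set.indicator_of_notMem hQD, zero_mul, add_zero]
          gcongr
          exact hpot.trans (ENNReal.ofReal_le_ofReal hle)
      · have h0 := (PMF.apply_eq_zero_iff _ _).2 hQ
        have h1 : D.indicator q Q = 0 := by
          rw [Set.indicator_apply, h0, ite_self]
        rw [h0, h1]
        simp
    have hsum := ENNReal.tsum_le_tsum hpt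
    rw [ENNReal.tsum_add, ENNReal.tsum_mul_right, ENNReal.tsum_mul_right, q.tsum_coe, one_mul,
      ← PMF.toOuterMeasure_apply] at hsum
    have hρq : ENNReal.ofReal ρ ≤ q.toOuterMeasure D :=
      ENNReal.ofReal_le_of_le_toReal h
    have hsum' : ∑' Q, q Q * potential s Q + ENNReal.ofReal (ρ * ((1 - θ) * V)) ≤
        ENNReal.ofReal V := by
      refine le_trans ?_ hsum
      rw [ENNReal.ofReal_mul hρ]
      gcongr
    rw [potential, if_neg hP, ← hV, ← ENNReal.ofReal_mul (by nlinarith)]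
    refine (ENNReal.le_sub_of_add_le_right ENNReal.ofReal_ne_top hsum').trans ?_
    rw [← ENNReal.ofReal_sub _ (by have : 0 ≤ 1 - θ := by linarith
                                   positivity)]
    exact ENNReal.ofReal_le_ofReal (by linarith)

/-- Markov's inequality: the potential starts at most at 1, and off the nearly uniform laws it is at
least `|G| ^ (-s/2)`. -/
theorem prob_not_nearUniform_mul_le {S : List G} {s ρ : ℝ} (hs : 0 ≤ s) (hρ : 0 ≤ ρ)
    (hρ1 : ρ ≤ 1)
    (h : ∀ P, ρ ≤ prob (step ha hb hc S P) {Q | l2norm Q ≤ 399 / 400 * l2norm P} ∨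
      NearUniform P) (n : ℕ) :
    prob (state ha hb hc S (n + 1)) {P | NearUniform P}ᶜ * (Fintype.card G : ℝ) ^ (-(s / 2)) ≤
      (1 - ρ * (1 - (399 / 400) ^ s)) ^ n := by
  classical
  set p := state ha hb hc S (n + 1)
  set m : ℝ := (Fintype.card G : ℝ) ^ (-(s / 2)) with hm
  have hc0 : (0 : ℝ) < Fintype.card G := by exact_mod_cast Fintype.card_pos
  have hθ0 : (0 : ℝ) ≤ (399 / 400) ^ s := by positivity
  have hθ1 : ((399 / 400 : ℝ)) ^ s ≤ 1 := Real.rpow_le_one (by norm_num) (by norm_num) hs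
  have hr : 0 ≤ 1 - ρ * (1 - (399 / 400 : ℝ) ^ s) := by nlinarith
  have h1 := tsum_state_mul_le ha hb hc
    (fun P => tsum_step_mul_potential_le ha hb hc hs P (h P) hρ) n
  have hone : potential s (PMF.pure (1 : G)) ≤ 1 := by
    unfold potential
    split_ifs
    · exact zero_le
    · rw [l2norm_pure_one, Real.one_rpow, ENNReal.ofReal_one]
  have hlow : ∀ P : PMF G, m ≤ l2norm P ^ s := by
    intro P
    have h2 : (Fintype.card G : ℝ)⁻¹ ≤ l2norm P ^ 2 := by
      rw [inv_le_iff_one_le_mul₀' hc0]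
      exact one_le_card_mul_l2norm_sq P
    have h3 := Real.rpow_le_rpow (by positivity) h2 (div_nonneg hs zero_le_two)
    rw [← Real.rpow_natCast, ← Real.rpow_mul (l2norm_nonneg P), Real.inv_rpow hc0.le,
      ← Real.rpow_neg hc0.le] at h3
    convert h3 using 2
    push_cast
    ring
  have hmarkov : p.toOuterMeasure {P | NearUniform P}ᶜ * ENNReal.ofReal m ≤
      ∑' Q, p Q * potential s Q := by
    rw [PMF.toOuterMeasure_apply, ← ENNReal.tsum_mul_right]
    refine ENNReal.tsum_le_tsum fun Q => ?_
    by_cases hQ : NearUniform Q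
    · rw [Set.indicator_of_notMem (by simpa using hQ), zero_mul]
      exact zero_le
    · rw [Set.indicator_of_mem (by simpa using hQ), potential, if_neg hQ]
      gcongr
      exact hlow Q
  have hfin := (hmarkov.trans h1).trans (mul_le_mul_right hone _)
  rw [mul_one, ← ENNReal.ofReal_pow hr] at hfin
  have h4 := ENNReal.toReal_mono ENNReal.ofReal_ne_top hfin
  rwa [ENNReal.toReal_mul, ENNReal.toReal_ofReal (by positivity),
    ENNReal.toReal_ofReal (by positivity)] at h4

end Algorithm

/-- The bound `log x ≤ x - 1` would leave no decay in the tail estimate; this one yields exactly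
`φ(1 - 1/φ)²/4`. -/
theorem log_le_half_sub_inv {x : ℝ} (hx : 1 ≤ x) : Real.log x ≤ (x - x⁻¹) / 2 := by
  have h := Real.self_le_sinh_iff.2 (Real.log_nonneg hx)
  rwa [Real.sinh_log (by linarith)] at h

/-! ### The exponential tail bound. -/

section Tail

variable {a b c : ℝ} (ha : 0 < a) (hb : 0 < b) (hc : 0 < c) {G : Type*} [Group G] [Fintype G]

theorem prob_not_nearUniform_le {S : List G} {ρ : ℝ} (hρ : 0 < ρ) (hρ1 : ρ ≤ 1)
    (h : ∀ P, ρ ≤ prob (step ha hb hc S P) {Q | l2norm Q ≤ 399 / 400 * l2norm P} ∨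
      NearUniform P) {φ : ℝ} (hφ : 1 < φ) (n : ℕ)
    (hn : φ * (1 / 2 * Real.logb (1 / (399 / 400)) (Fintype.card G)) ≤ ρ * n) :
    prob (state ha hb hc S (n + 1)) {P | NearUniform P}ᶜ ≤
      Real.exp (-(φ * (1 - 1 / φ) ^ 2 / 4 *
        Real.logb (1 / (399 / 400)) (Fintype.card G))) := by
  set N : ℝ := (Fintype.card G : ℝ) with hN
  have hN1 : 1 ≤ N := Nat.one_le_cast.2 Fintype.card_pos
  have hφ0 : 0 < φ := by linarith
  set ℓ : ℝ := Real.log (1 / (399 / 400)) with hℓdef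
  have hℓ : 0 < ℓ := Real.log_pos (by norm_num)
  set L := Real.logb (1 / (399 / 400)) N with hLdef
  have hL : L * ℓ = Real.log N := by
    rw [hLdef, Real.logb]
    exact div_mul_cancel₀ _ hℓ.ne'
  have hL0 : 0 ≤ L := Real.logb_nonneg (by norm_num) hN1
  -- Chosen so that `(399/400) ^ s = 1/φ`, which minimises the exponent `(L/2)(s * ℓ) - ρ * n * (1 -
  -- (399/400) ^ s)` when `ρ * n = φ * L / 2`.
  set s : ℝ := Real.log φ / ℓ with hs
  have hlφ : 0 < Real.log φ := Real.log_pos hφ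
  have hs0 : 0 ≤ s := by positivity
  have hsℓ : s * ℓ = Real.log φ := div_mul_cancel₀ _ hℓ.ne'
  have hθ : (399 / 400 : ℝ) ^ s = φ⁻¹ := by
    rw [Real.rpow_def_of_pos (by norm_num), ← Real.exp_log hφ0, ← Real.exp_neg, ← hsℓ, hℓdef,
      one_div, Real.log_inv]
    congr 1
    ring
  have hmain := prob_not_nearUniform_mul_le ha hb hc hs0 hρ.le hρ1 h n
  rw [hθ] at hmain
  have hNs : N ^ (-(s / 2)) = Real.exp (-(Real.log φ * L / 2)) := by
    rw [Real.rpow_def_of_pos (by linarith), ← hL, ← hsℓ]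
    congr 1
    ring
  have hinv : φ⁻¹ < 1 := inv_lt_one_of_one_lt₀ hφ
  have hinv0 : 0 < φ⁻¹ := by positivity
  have hpow : (1 - ρ * (1 - φ⁻¹)) ^ n ≤ Real.exp (-(ρ * n * (1 - φ⁻¹))) := by
    have h1 : 1 - ρ * (1 - φ⁻¹) ≤ Real.exp (-(ρ * (1 - φ⁻¹))) := by
      linarith [Real.add_one_le_exp (-(ρ * (1 - φ⁻¹)))]
    refine (pow_le_pow_left₀ (by nlinarith) h1 n).trans_eq ?_
    rw [← Real.exp_nat_mul]
    congr 1
    ring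
  rw [← hN, hNs, Real.exp_neg, ← div_eq_mul_inv, div_le_iff₀ (Real.exp_pos _)] at hmain
  refine hmain.trans ((mul_le_mul_of_nonneg_right hpow (Real.exp_pos _).le).trans ?_)
  rw [← Real.exp_add]
  refine Real.exp_le_exp.2 ?_
  have h2 := mul_le_mul_of_nonneg_right hn (by linarith : 0 ≤ 1 - φ⁻¹)
  have h3 := mul_le_mul_of_nonneg_right (log_le_half_sub_inv hφ.le) hL0
  have h4 : φ * φ⁻¹ = 1 := mul_inv_cancel₀ hφ0.ne'
  have h5 : φ * (1 - 1 / φ) ^ 2 = φ - 2 + φ⁻¹ := by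
    field_simp
    ring
  have h6 : φ * (1 / 2 * L) * (1 - φ⁻¹) = (φ - 1) * L / 2 := by
    linear_combination -(1 / 2 * L) * h4
  rw [h5]
  rw [h6] at h2
  linarith

end Tail

end FibonacciCube

theorem mainTheorem2 {a b c : ℝ} (ha : 0 < a) (hb : 0 < b) (hc : 0 < c) :
    ∃ α ρ β ι : ℝ, 0 < α ∧ α < 1 ∧ 0 < ρ ∧ 0 < β ∧ β < 1 ∧ 0 < ι ∧
      ∀ (G : Type*) [Group G] [Fintype G] (S : List G), Subgroup.closure {g | g ∈ S} = ⊤ →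
        (∀ i : ℕ, ι * Real.log (Fintype.card G) < i →
          ∀ P ∈ (FibonacciCube.state ha hb hc S i).support,
            ρ ≤ FibonacciCube.prob (FibonacciCube.step ha hb hc S P)
                {Q | FibonacciCube.l2norm Q ≤ α * FibonacciCube.l2norm P} ∨
            FibonacciCube.SemiUniform β P) ∧
        (∀ φ : ℝ, 1 < φ → ∀ i : ℕ,
          ι * Real.log (Fintype.card G) +
              (φ / ρ) * (1 + (1 / 2) * Real.logb (1 / α) (Fintype.card G)) ≤ i →
            1 - Real.exp (-(φ * (1 - 1 / φ) ^ 2 / 4 * Real.logb (1 / α) (Fintype.card G))) ≤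
              FibonacciCube.prob (FibonacciCube.state ha hb hc S i)
                {P | FibonacciCube.SemiUniform β P}) := by
  have hmin : 0 < min (FibonacciCube.caseWeight a b c 0) (FibonacciCube.caseWeight a b c 2) :=
    lt_min (FibonacciCube.caseWeight_pos ha hb hc 0) (FibonacciCube.caseWeight_pos ha hb hc 2)
  set ρ : ℝ := min (FibonacciCube.caseWeight a b c 0) (FibonacciCube.caseWeight a b c 2) / 10
    with hρdef
  have hρ : 0 < ρ := by positivity
  have hρ1 : ρ ≤ 1 := by
    have h0 := FibonacciCube.caseLaw_toReal ha hb hc 0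
    have h1 : (FibonacciCube.caseLaw ha hb hc 0).toReal ≤ 1 :=
      ENNReal.toReal_mono ENNReal.one_ne_top (PMF.coe_le_one _ _)
    rw [hρdef]
    linarith [min_le_left (FibonacciCube.caseWeight a b c 0) (FibonacciCube.caseWeight a b c 2)]
  -- The value `ι = 1` is arbitrary: the dichotomy needs no initial waiting time.
  refine ⟨399 / 400, ρ, 1 / 2, 1, by norm_num, by norm_num, hρ, by norm_num, by norm_num,
    one_pos, ?_⟩
  intro G _ _ S hS
  have hstep := FibonacciCube.le_prob_step_or_nearUniform ha hb hc hS
  refine ⟨fun i _ P _ => (hstep P).imp_right FibonacciCube.NearUniform.semiUniform, ?_⟩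
  intro φ hφ i hi
  have hN1 : (1 : ℝ) ≤ Fintype.card G := by exact_mod_cast Fintype.card_pos (α := G)
  have hlog : 0 ≤ Real.log (Fintype.card G) := Real.log_nonneg hN1
  have hL0 : 0 ≤ Real.logb (1 / (399 / 400)) (Fintype.card G : ℝ) :=
    Real.logb_nonneg (by norm_num) hN1
  have hi' : φ * (1 + 1 / 2 * Real.logb (1 / (399 / 400)) (Fintype.card G : ℝ)) ≤ ρ * i := by
    have h1 : φ / ρ * (1 + 1 / 2 * Real.logb (1 / (399 / 400)) (Fintype.card G : ℝ)) ≤ i := by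
      linarith
    rw [div_mul_eq_mul_div, div_le_iff₀ hρ] at h1
    linarith
  obtain _ | n := i
  · exfalso
    simp only [Nat.cast_zero, mul_zero] at hi'
    nlinarith
  push_cast at hi'
  -- Time `n + 1` comes after only `n` steps; the summand 1 in the waiting time pays for this, since
  -- `φ > 1 ≥ ρ`.
  have htail := FibonacciCube.prob_not_nearUniform_le ha hb hc hρ hρ1 hstep hφ n (by linarith)
  have hcompl := FibonacciCube.prob_add_prob_compl (FibonacciCube.state ha hb hc S (n + 1))
    {P : PMF G | FibonacciCube.NearUniform P}
  have hmono : FibonacciCube.prob (FibonacciCube.state ha hb hc S (n + 1))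
        {P : PMF G | FibonacciCube.NearUniform P} ≤
      FibonacciCube.prob (FibonacciCube.state ha hb hc S (n + 1))
        {P | FibonacciCube.SemiUniform (1 / 2) P} :=
    FibonacciCube.prob_mono _ fun P hP => FibonacciCube.NearUniform.semiUniform hP
  linarith
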